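/- Work in ZFC. For a formula $\phi$ of the language of set theory and a set $M$, the relativization $\phi^M$ is obtained from $\phi$ by replacing every quantifier $\forall x$, $\exists x$ by $\forall x\in M$, $\exists x\in M$; the formula $\phi$, with free variables $x_1,\dots,x_n$, is \emph{absolute for $M$} if $\phi^M(a_1,\dots,a_n)\Leftrightarrow\phi(a_1,\dots,a_n)$ for all $a_1,\dots,a_n\in M$. For a finite list of formulas $\phi_1,\dots,\phi_n$ and a countable set $Y$, write $M\prec(\phi_1,\dots,\phi_n;Y)$ if $M$ is a countable set, $Y\subset M$, and $\phi_1,\dots,\phi_n$ are absolute for $M$. Proposition. There are a finite list of formulas $\phi_1,\dots,\phi_n$ and a countable set $Y$ such that every $M\prec(\phi_1,\dots,\phi_n;Y)$ has the following property. Let $X$ be a (real or complex) Banach space and let $K\subset X$ be weakly compact. If $X\in M$ (meaning that the tuple $(X,+,\cdot,\|\cdot\|)$ belongs to $M$) and $K\in M$, then $$K\subset\overline{X\cap M}+(X^*\cap M)_\perp,$$ where $\overline{X\cap M}$ is the norm closure in $X$ of the set of points of $X$ that belong to $M$, and $(X^*\cap M)_\perp=\{x\in X: f(x)=0\text{ for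 every } f\in X^*\cap M\}$, with $X^*$ the space of continuous linear functionals on $X$. -/

import Mathlib

open scoped Pointwise

universe u

namespace ElementaryModel

/-! ### The language of set theory, relativization, absoluteness -/

/-- The only non-logical symbol of the language of set theory: the binary relation symbol `∈`. -/
inductive SetRel : ℕ → Type
  | mem : SetRel 2

/-- The first-order language of set theory (with equality). -/
abbrev setLanguage : FirstOrder.Language.{0, 0} := ⟨fun _ => Empty, SetRel⟩

/-- The universe of sets as a structure for the language of set theory. -/
instance : setLanguage.Structure ZFSet.{u} where
  funMap := fun f => Empty.elim f
  RelMap := fun {_} r =>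
    match r with
    | SetRel.mem => fun xs => xs 0 ∈ xs 1

/-- Formulas of the language of set theory; the free variables are among `x₀, x₁, x₂, …`. -/
abbrev SetFormula : Type := setLanguage.Formula ℕ

/-- Truth in the universe of the relativization to `N` of a formula: every quantifier
`∀ x` (hence every `∃ x`, which is `¬ ∀ x ¬`) is replaced by `∀ x ∈ N`. -/
def RelativizedTo (N : ZFSet.{u}) :
    ∀ {n : ℕ}, setLanguage.BoundedFormula ℕ n → (ℕ → ZFSet.{u}) → (Fin n → ZFSet.{u}) → Prop
  | _, .falsum, _, _ => False
  | _, .equal t₁ t₂, a, xs => t₁.realize (Sum.elim a xs) = t₂.realize (Sum.elim a xs)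
  | _, .rel R ts, a, xs => FirstOrder.Language.Structure.RelMap R fun i => (ts i).realize (Sum.elim a xs)
  | _, .imp φ ψ, a, xs => RelativizedTo N φ a xs → RelativizedTo N ψ a xs
  | _, .all φ, a, xs => ∀ x ∈ N, RelativizedTo N φ a (Fin.snoc xs x)

/-- `φ` is absolute for `N`: whenever the free variables of `φ` take values in `N`, the
relativization `φ^N` holds if and only if `φ` holds. -/
def IsAbsolute (φ : SetFormula) (N : ZFSet.{u}) : Prop :=
  ∀ a : ℕ → ZFSet.{u}, (∀ i ∈ φ.freeVarFinset, a i ∈ N) →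
    (RelativizedTo N φ a default ↔ φ.Realize a)

/-- `M ≺ (φ₁, …, φₙ; Y)`: the set `M` is countable, contains `Y`, and every formula of the list is
absolute for `M`. -/
structure IsElementaryModel (Φ : List SetFormula) (Y M : ZFSet.{u}) : Prop where
  countable : (M : Set ZFSet.{u}).Countable
  subset : Y ⊆ M
  absolute : ∀ φ ∈ Φ, IsAbsolute φ M

/-- "For any suitable elementary model `M`, `P M`": there are a finite list of formulas and a
countable set `Y` such that `P M` holds for every `M ≺ (φ₁, …, φₙ; Y)`. -/
def ForSuitableModels (P : ZFSet.{u} → Prop) : Prop :=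
  ∃ (Φ : List SetFormula) (Y : ZFSet.{u}), (Y : Set ZFSet.{u}).Countable ∧
    ∀ M : ZFSet.{u}, IsElementaryModel Φ Y M → P M

/-! ### Numbers as sets -/

/-- Natural numbers as von Neumann ordinals. -/
def natSet : ℕ → ZFSet.{u}
  | 0 => ∅
  | n + 1 => insert (natSet n) (natSet n)

/-- An integer `z`, as the pair `(m, n)` of natural numbers with `z = m - n` and `m = 0` or
`n = 0`. -/
def intSet (z : ℤ) : ZFSet.{u} := ZFSet.pair (natSet z.toNat) (natSet (-z).toNat)

/-- A rational number, as the pair of its reduced numerator and denominator. -/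
def ratSet (q : ℚ) : ZFSet.{u} := ZFSet.pair (intSet q.num) (natSet q.den)

/-- A real number, as its (lower, open) Dedekind cut. -/
noncomputable def cutSet (r : ℝ) : ZFSet.{u} :=
  ZFSet.range fun q : {q : ℚ // (q : ℝ) < r} => ratSet.{u} q

/-- A real or complex number, as the pair of its real and imaginary parts. In particular `ℝ` is
the subset `{(r, 0)}` of `ℂ`. -/
noncomputable def scalarSet {𝕜 : Type} [RCLike 𝕜] (z : 𝕜) : ZFSet.{u} :=
  ZFSet.pair (cutSet (RCLike.re z)) (cutSet (RCLike.im z))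

/-! ### Banach spaces as sets

The points of the Banach space are the elements of a set `X`, that is, the space is a Mathlib
Banach space structure on the type `↥X` of elements of `X`. -/

section BanachSpace

variable (𝕜 : Type) [RCLike 𝕜] (X : ZFSet.{u}) [NormedAddCommGroup X] [NormedSpace 𝕜 X]

/-- The addition `X × X → X` as a set of ordered pairs. -/
noncomputable def additionSet : ZFSet.{u} :=
  ZFSet.range fun p : X × X =>
    ZFSet.pair (ZFSet.pair p.1 p.2) ((p.1 + p.2 : X) : ZFSet.{u})

/-- The multiplication by scalars `𝕜 × X → X` as a set of ordered pairs. -/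
noncomputable def smulSet : ZFSet.{u} :=
  ZFSet.range fun p : 𝕜 × X =>
    ZFSet.pair (ZFSet.pair (scalarSet p.1) p.2) ((p.1 • p.2 : X) : ZFSet.{u})

/-- The norm `X → ℝ` as a set of ordered pairs. -/
noncomputable def normSet : ZFSet.{u} :=
  ZFSet.range fun x : X => ZFSet.pair (x : ZFSet.{u}) (scalarSet ‖x‖)

/-- The Banach space as a set: the tuple `(X, +, ·, ‖·‖)`. -/
noncomputable def banachSpaceSet : ZFSet.{u} :=
  ZFSet.pair X (ZFSet.pair (additionSet X) (ZFSet.pair (smulSet 𝕜 X) (normSet X)))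

variable {𝕜 X}

/-- A continuous linear functional `X → 𝕜` as a set of ordered pairs. -/
noncomputable def functionalSet (f : StrongDual 𝕜 X) : ZFSet.{u} :=
  ZFSet.range fun x : X => ZFSet.pair (x : ZFSet.{u}) (scalarSet (f x))

variable (𝕜 X)

/-- `X ∩ M`, as a subset of the Banach space. -/
def pointsIn (M : ZFSet.{u}) : Set X := {x | (x : ZFSet.{u}) ∈ M}

/-- `X* ∩ M`, as a subset of the dual. -/
def functionalsIn (M : ZFSet.{u}) : Set (StrongDual 𝕜 X) := {f | functionalSet f ∈ M}

/-- A subset of the Banach space as a set. -/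
noncomputable def subsetSet {X : ZFSet.{u}} (K : Set X) : ZFSet.{u} :=
  ZFSet.range fun x : K => ((x : X) : ZFSet.{u})

variable {𝕜 X}

/-- The annihilator `D_⊥ = {x ∈ X : f x = 0 for all f ∈ D}` of a set `D ⊆ X*`. -/
def preAnnihilator (D : Set (StrongDual 𝕜 X)) : Set X := {x | ∀ f ∈ D, f x = 0}

end BanachSpace

end ElementaryModel

/-! Absoluteness of `φ` and of `∃ x₀, φ` gives `M` a witness for each satisfied existential
statement with parameters in `M` (`exists_mem`), so `M` is closed under the definable operations
needed (`sep_mem`). Fix `x ∈ K` and finitely many functionals in `X* ∩ M`. Cutting `K` by rational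
bounds on their values near those at `x` gives a set that belongs to `M` and contains `x`, so it
also contains a point of `M`. Hence points of `K ∩ M` approximate `x` on finite subsets of `X* ∩ M`.
Weak compactness turns these approximations into one `z ∈ K`, in the weak closure of `X ∩ M`, with
`f z = f x` for all `f ∈ X* ∩ M`. As `X ∩ M` has midpoints, its norm closure is convex, hence weakly
closed, and contains `z`. Then `x = z + (x - z)`. -/

namespace ElementaryModel

open FirstOrder FirstOrder.Language

/-! ### Relativization as truth in a substructure -/

/-- The elements of a set `N`, with the membership relation inherited from the universe. -/
instance (N : ZFSet.{u}) : setLanguage.Structure N where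
  funMap := fun f => Empty.elim f
  RelMap := fun r xs => Structure.RelMap r fun i => (xs i : ZFSet.{u})

theorem coe_term_realize {N : ZFSet.{u}} {α : Type} (t : setLanguage.Term α) (a : α → N) :
    ((t.realize a : N) : ZFSet.{u}) = t.realize fun i => (a i : ZFSet.{u}) := by
  cases t with
  | var => rfl
  | func f => exact Empty.elim f

theorem coe_sumElim {N : ZFSet.{u}} {n : ℕ} (a : ℕ → N) (xs : Fin n → N) :
    (fun i => ((Sum.elim a xs i : N) : ZFSet.{u})) =
      Sum.elim (fun i => (a i : ZFSet.{u})) fun i => (xs i : ZFSet.{u}) := by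
  funext i; cases i <;> rfl

theorem relativizedTo_iff_realize {N : ZFSet.{u}} {n : ℕ} (φ : setLanguage.BoundedFormula ℕ n)
    (a : ℕ → N) (xs : Fin n → N) :
    RelativizedTo N φ (fun i => a i) (fun i => xs i) ↔ φ.Realize a xs := by
  induction φ with
  | falsum => rfl
  | equal t₁ t₂ =>
    simp only [RelativizedTo, BoundedFormula.Realize, Subtype.ext_iff, coe_term_realize,
      coe_sumElim]
  | rel R ts =>
    change Structure.RelMap R _ ↔
      Structure.RelMap R fun i => (((ts i).realize (Sum.elim a xs) : N) : ZFSet.{u})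
    simp only [coe_term_realize, coe_sumElim]
  | imp φ ψ ihφ ihψ => simp only [RelativizedTo, BoundedFormula.Realize, ihφ, ihψ]
  | all φ ih =>
    simp only [RelativizedTo, BoundedFormula.Realize, ← ih, Subtype.forall]
    refine forall₂_congr fun x hx => iff_of_eq (congrArg _ ?_)
    funext i
    refine Fin.lastCases ?_ (fun j => ?_) i <;> simp

/-! ### Definable predicates -/

/-- The formula `∃ x₀, φ(x₀, x₁, …)`, with the remaining variables shifted down by one. -/
noncomputable def exFormula (φ : SetFormula) : SetFormula :=
  (Formula.relabel (fun n : ℕ => Nat.casesOn n (Sum.inr ()) Sum.inl : ℕ → ℕ ⊕ Unit) φ).iExs Unit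

/-- The sequence `y, a₀, a₁, …`. -/
def consSeq {α : Type*} (y : α) (a : ℕ → α) : ℕ → α
  | 0 => y
  | n + 1 => a n

theorem realize_exFormula {S : Type*} [setLanguage.Structure S] (φ : SetFormula) (a : ℕ → S) :
    (exFormula φ).Realize a ↔ ∃ y, φ.Realize (consSeq y a) := by
  have key (i : Unit → S) :
      Sum.elim a i ∘ (fun n : ℕ => Nat.casesOn n (Sum.inr ()) Sum.inl : ℕ → ℕ ⊕ Unit) =
        consSeq (i ()) a := by
    funext n; cases n <;> rfl
  simp only [exFormula, Formula.realize_iExs, Formula.realize_relabel, key]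
  exact ⟨fun ⟨i, h⟩ => ⟨_, h⟩, fun ⟨y, h⟩ => ⟨fun _ => y, h⟩⟩

/-- A predicate of sequences of sets that is expressed by a formula of set theory. -/
def DefinablePred (P : (ℕ → ZFSet.{u}) → Prop) : Prop :=
  ∃ φ : SetFormula, ∀ a, φ.Realize a ↔ P a

namespace DefinablePred

variable {P Q : (ℕ → ZFSet.{u}) → Prop}

theorem of_iff (hP : DefinablePred P) (h : ∀ a, Q a ↔ P a) : DefinablePred Q :=
  hP.imp fun _ hφ a => (hφ a).trans (h a).symm

theorem mem (i j : ℕ) : DefinablePred.{u} fun a => a i ∈ a j :=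
  ⟨Relations.formula₂ (L := setLanguage) SetRel.mem (Term.var i) (Term.var j), fun a => by
    rw [Formula.realize_rel₂]; rfl⟩

theorem eq (i j : ℕ) : DefinablePred.{u} fun a => a i = a j :=
  ⟨Term.equal (Term.var i) (Term.var j), fun a => by simp [Formula.realize_equal]⟩

theorem not (hP : DefinablePred P) : DefinablePred fun a => ¬ P a :=
  let ⟨φ, hφ⟩ := hP
  ⟨φ.not, fun a => by rw [Formula.realize_not, hφ]⟩

theorem and (hP : DefinablePred P) (hQ : DefinablePred Q) : DefinablePred fun a => P a ∧ Q a :=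
  let ⟨φ, hφ⟩ := hP
  let ⟨ψ, hψ⟩ := hQ
  ⟨φ ⊓ ψ, fun a => by rw [Formula.realize_inf, hφ, hψ]⟩

theorem or (hP : DefinablePred P) (hQ : DefinablePred Q) : DefinablePred fun a => P a ∨ Q a :=
  (hP.not.and hQ.not).not.of_iff fun a => by tauto

theorem iff (hP : DefinablePred P) (hQ : DefinablePred Q) : DefinablePred fun a => (P a ↔ Q a) :=
  ((hP.and hQ).or (hP.not.and hQ.not)).of_iff fun a => by tauto

/-- De Bruijn convention: the bound variable gets index `0` and each outer index goes up by one,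
which explains the numerals below. -/
theorem ex {R : ZFSet.{u} → (ℕ → ZFSet.{u}) → Prop}
    (hR : DefinablePred fun a => R (a 0) fun n => a (n + 1)) :
    DefinablePred fun a => ∃ y, R y a :=
  let ⟨φ, hφ⟩ := hR
  ⟨exFormula φ, fun a => by simp only [realize_exFormula, hφ]; rfl⟩

theorem all {R : ZFSet.{u} → (ℕ → ZFSet.{u}) → Prop}
    (hR : DefinablePred fun a => R (a 0) fun n => a (n + 1)) :
    DefinablePred fun a => ∀ y, R y a :=
  (ex (R := fun y a => ¬ R y a) hR.not).not.of_iff fun a => by simp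

theorem eq_pair (i j k : ℕ) : DefinablePred.{u} fun a => a i = ZFSet.pair (a j) (a k) := by
  have h : DefinablePred.{u} fun a => ∀ z, z ∈ a i ↔
      (∀ w, w ∈ z ↔ w = a j) ∨ ∀ w, w ∈ z ↔ w = a j ∨ w = a k :=
    all ((mem _ _).iff ((all ((mem 0 1).iff (eq 0 (j + 2)))).or
      (all ((mem 0 1).iff ((eq 0 (j + 2)).or (eq 0 (k + 2)))))))
  exact h.of_iff fun a => by simp [ZFSet.ext_iff, ZFSet.pair]

theorem pair_mem (i j k : ℕ) : DefinablePred.{u} fun a => ZFSet.pair (a i) (a j) ∈ a k := by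
  have h : DefinablePred.{u} fun a => ∃ p, p = ZFSet.pair (a i) (a j) ∧ p ∈ a k :=
    ex ((eq_pair 0 (i + 1) (j + 1)).and (mem 0 (k + 1)))
  exact h.of_iff fun a => by simp

theorem pair_pair_mem_right (i j k l : ℕ) :
    DefinablePred.{u} fun a => ZFSet.pair (a i) (ZFSet.pair (a j) (a k)) ∈ a l := by
  have h : DefinablePred.{u} fun a => ∃ p, p = ZFSet.pair (a j) (a k) ∧ ZFSet.pair (a i) p ∈ a l :=
    ex ((eq_pair 0 (j + 1) (k + 1)).and (pair_mem (i + 1) 0 (l + 1)))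
  exact h.of_iff fun a => by simp

theorem pair_pair_mem_left (i j k l : ℕ) :
    DefinablePred.{u} fun a => ZFSet.pair (ZFSet.pair (a i) (a j)) (a k) ∈ a l := by
  have h : DefinablePred.{u} fun a => ∃ p, p = ZFSet.pair (a i) (a j) ∧ ZFSet.pair p (a k) ∈ a l :=
    ex ((eq_pair 0 (i + 1) (j + 1)).and (pair_mem 0 (k + 1) (l + 1)))
  exact h.of_iff fun a => by simp

end DefinablePred

/-! ### Suitable models -/

namespace ForSuitableModels

variable {P Q : ZFSet.{u} → Prop}

theorem mono (hP : ForSuitableModels P) (h : ∀ M, P M → Q M) : ForSuitableModels Q :=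
  let ⟨Φ, Y, hY, hM⟩ := hP
  ⟨Φ, Y, hY, fun M hMΦ => h M (hM M hMΦ)⟩

theorem and (hP : ForSuitableModels P) (hQ : ForSuitableModels Q) :
    ForSuitableModels fun M => P M ∧ Q M := by
  obtain ⟨Φ, Y, hY, hP⟩ := hP
  obtain ⟨Ψ, Z, hZ, hQ⟩ := hQ
  refine ⟨Φ ++ Ψ, Y ∪ Z, ?_, fun M hM => ⟨hP M ⟨hM.countable, ?_, ?_⟩, hQ M ⟨hM.countable, ?_, ?_⟩⟩⟩
  · refine (hY.union hZ).mono fun x hx => ?_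
    simpa using hx
  · exact fun x hx => hM.subset (ZFSet.mem_union.2 (.inl hx))
  · exact fun φ hφ => hM.absolute φ (List.mem_append_left _ hφ)
  · exact fun x hx => hM.subset (ZFSet.mem_union.2 (.inr hx))
  · exact fun φ hφ => hM.absolute φ (List.mem_append_right _ hφ)

theorem range_mem {ι : Type} [Countable ι] (s : ι → ZFSet.{u}) :
    ForSuitableModels.{u} fun M => ∀ i, s i ∈ M := by
  refine ⟨[], ZFSet.range s, ?_, fun M hM i => hM.subset (ZFSet.mem_range.2 ⟨i, rfl⟩)⟩
  refine (Set.countable_range s).mono fun x hx => ?_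
  simpa using hx

/-- A suitable model that contains the parameters of a definable property contains a witness of
this property, if there is one. -/
theorem exists_mem {R : ZFSet.{u} → (ℕ → ZFSet.{u}) → Prop}
    (hR : DefinablePred fun a => R (a 0) fun n => a (n + 1)) :
    ForSuitableModels.{u} fun M =>
      ∀ a : ℕ → ZFSet.{u}, (∀ i, a i ∈ M) → (∃ y, R y a) → ∃ y ∈ M, R y a := by
  obtain ⟨φ, hφ⟩ := hR
  have hφ' (y : ZFSet.{u}) (a) : φ.Realize (consSeq y a) ↔ R y a := hφ _
  -- Absoluteness of `exFormula φ` brings existence down to `M`; that of `φ` carries the witness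
  -- back up.
  refine ⟨[φ, exFormula φ], ∅, by simp, fun M hM a ha hy => ?_⟩
  have hrel (ψ : SetFormula) (hψ : IsAbsolute ψ M) (b : ℕ → M) :
      ψ.Realize b ↔ ψ.Realize fun i => (b i : ZFSet.{u}) := by
    rw [← hψ _ fun i _ => (b i).2, Formula.Realize, ← relativizedTo_iff_realize]
    exact iff_of_eq (congrArg _ (Subsingleton.elim _ _))
  let b : ℕ → M := fun i => ⟨a i, ha i⟩
  have h₁ : (exFormula φ).Realize b := by
    rw [hrel _ (hM.absolute _ (by simp)), realize_exFormula]
    simpa only [hφ'] using hy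
  rw [realize_exFormula] at h₁
  obtain ⟨y, h₂⟩ := h₁
  rw [hrel _ (hM.absolute _ (by simp)),
    show (fun i => ((consSeq y b i : M) : ZFSet.{u})) = consSeq (y : ZFSet.{u}) a by
      funext i; cases i <;> rfl, hφ'] at h₂
  exact ⟨y, y.2, h₂⟩

theorem exists_mem_of_nonempty :
    ForSuitableModels.{u} fun M => ∀ L ∈ M, ∀ x ∈ L, ∃ y ∈ M, y ∈ L :=
  (exists_mem (R := fun y a => y ∈ a 0) (.mem 0 1)).mono fun _ hM L hL x hx =>
    hM (fun _ => L) (fun _ => hL) ⟨x, hx⟩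

theorem pair_components_mem :
    ForSuitableModels.{u} fun M => ∀ x y, ZFSet.pair x y ∈ M → x ∈ M ∧ y ∈ M := by
  have h₁ := exists_mem.{u} (R := fun x a => ∃ y, a 0 = ZFSet.pair x y) (.ex (.eq_pair 2 1 0))
  have h₂ := exists_mem.{u} (R := fun y a => ∃ x, a 0 = ZFSet.pair x y) (.ex (.eq_pair 2 0 1))
  refine (h₁.and h₂).mono fun M hM x y hxy => ⟨?_, ?_⟩
  · obtain ⟨x', hx', y', h⟩ := hM.1 (fun _ => ZFSet.pair x y) (fun _ => hxy) ⟨x, y, rfl⟩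
    rwa [(ZFSet.pair_inj.1 h).1]
  · obtain ⟨y', hy', x', h⟩ := hM.2 (fun _ => ZFSet.pair x y) (fun _ => hxy) ⟨y, x, rfl⟩
    rwa [(ZFSet.pair_inj.1 h).2]

/-- By extensionality the defining property has only one witness, so the witness found in `M` is the
set itself. -/
theorem sep_mem {R : ZFSet.{u} → (ℕ → ZFSet.{u}) → Prop}
    (hR : DefinablePred fun a => R (a 0) fun n => a (n + 1)) :
    ForSuitableModels.{u} fun M => ∀ a : ℕ → ZFSet.{u}, (∀ i, a i ∈ M) →
      ZFSet.sep (fun p => R p a) (a 0) ∈ M := by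
  obtain ⟨φ, hφ⟩ := hR
  have hdef : DefinablePred.{u} fun a => R (a 0) fun n => a (n + 2) := by
    -- Index `1` is left free for the set `z` being defined.
    refine ⟨Formula.relabel (fun n : ℕ => Nat.casesOn n 0 fun m => m + 2 : ℕ → ℕ) φ, fun a => ?_⟩
    rw [Formula.realize_relabel, hφ]
    rfl
  have h := exists_mem.{u} (R := fun z a => ∀ p, p ∈ z ↔ p ∈ a 0 ∧ R p a)
    (.all ((DefinablePred.mem 0 1).iff ((DefinablePred.mem 0 2).and hdef)))
  refine h.mono fun M hM a ha => ?_
  obtain ⟨z, hz, h⟩ := hM a ha ⟨ZFSet.sep (fun p => R p a) (a 0), fun p => ZFSet.mem_sep⟩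
  rwa [show ZFSet.sep (fun p => R p a) (a 0) = z from ZFSet.ext fun p => by rw [ZFSet.mem_sep, h p] ]

end ForSuitableModels

end ElementaryModel

/-! ### Convexity and weak compactness in normed spaces -/

theorem IsClosed.convex_of_midpoint_mem {E : Type*} [NormedAddCommGroup E] [NormedSpace ℝ E]
    {s : Set E} (hs : IsClosed s) (h : ∀ x ∈ s, ∀ y ∈ s, midpoint ℝ x y ∈ s) : Convex ℝ s := by
  refine convex_iff_segment_subset.2 fun x hx y hy => ?_
  rw [segment_eq_image_lineMap, Set.image_subset_iff]
  have hcont : Continuous (AffineMap.lineMap x y : ℝ → E) := AffineMap.lineMap_continuous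
  refine ((hs.preimage hcont).inter isClosed_Icc).Icc_subset_of_forall_exists_gt
    (by simpa using hx) ?_
  rintro t ⟨ht, ht0, ht1⟩ r (hr : t < r)
  -- Repeated halving from `y` towards the point at `t` gives parameters in the set arbitrarily
  -- close to `t` from the right.
  have key (n : ℕ) : AffineMap.lineMap x y (t + (1 - t) * (1 / 2) ^ n) ∈ s := by
    induction n with
    | zero => simpa using hy
    | succ n ih =>
      have := h _ ht _ ih
      rw [← AffineMap.map_midpoint] at this
      convert this using 2
      rw [midpoint_eq_smul_add, smul_eq_mul, invOf_eq_inv]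
      ring
  obtain ⟨n, hn⟩ := exists_pow_lt_of_lt_one (sub_pos.2 hr) (by norm_num : (1 / 2 : ℝ) < 1)
  have hpos : (0 : ℝ) < (1 / 2) ^ n := by positivity
  refine ⟨_, key n, ?_, ?_⟩
  · nlinarith
  · nlinarith

/-- A weakly compact set `K` is contained in `closure S + D_⊥` if `S` is closed under midpoints and
the points of `K` are approximated on finite subsets of `D` by points of `K ∩ S`. -/
theorem subset_closure_add_of_isCompact_toWeakSpace {𝕜 E : Type*} [RCLike 𝕜]
    [NormedAddCommGroup E] [NormedSpace 𝕜 E] {K S : Set E} {D : Set (StrongDual 𝕜 E)}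
    (hK : IsCompact (toWeakSpace 𝕜 E '' K))
    (hS : ∀ x ∈ S, ∀ y ∈ S, ∃ m ∈ S, m + m = x + y)
    (hD : ∀ x ∈ K, ∀ F : Finset (StrongDual 𝕜 E), ↑F ⊆ D → ∀ ε : ℝ, 0 < ε →
      ∃ y ∈ K, y ∈ S ∧ ∀ f ∈ F, ‖f y - f x‖ < ε) :
    K ⊆ closure S + {x | ∀ f ∈ D, f x = 0} := by
  classical
  let _ : NormedSpace ℝ E := NormedSpace.restrictScalars ℝ 𝕜 E
  have _ : IsScalarTower ℝ 𝕜 E := RestrictScalars.isScalarTower ℝ 𝕜 E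
  have hconv : Convex ℝ (closure S) := by
    refine isClosed_closure.convex_of_midpoint_mem fun x hx y hy => ?_
    refine map_mem_closure₂ (f := fun x y : E => midpoint ℝ x y) ?_ hx hy fun x hx y hy => ?_
    · simp only [midpoint_eq_smul_add]
      fun_prop
    · obtain ⟨m, hm, h⟩ := hS x hx y hy
      rwa [midpoint_eq_smul_add, ← h, ← two_smul ℝ m, smul_smul, invOf_mul_self, one_smul]
  intro x hx
  let t : D × ℕ → Set (WeakSpace 𝕜 E) := fun i =>
    {z | ‖i.1.1 ((toWeakSpace 𝕜 E).symm z) - i.1.1 x‖ ≤ 1 / ((i.2 : ℝ) + 1)}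
  have ht (i) : IsClosed (t i) := by
    have hc : Continuous fun z : WeakSpace 𝕜 E => i.1.1 ((toWeakSpace 𝕜 E).symm z) :=
      WeakBilin.eval_continuous (topDualPairing 𝕜 E).flip i.1.1
    exact isClosed_le (hc.sub continuous_const).norm continuous_const
  -- Finite intersection property in `K` cut with the weak closure; the largest index `n` involved
  -- fixes the tolerance.
  obtain ⟨z, ⟨-, hz⟩, hzt⟩ := (hK.inter_right
      (isClosed_closure (s := toWeakSpace 𝕜 E '' closure S))).inter_iInter_nonempty t ht (by
    intro v
    obtain ⟨y, hyK, hyS, hy⟩ := hD x hx (v.image fun i => i.1.1)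
      (by intro f hf; obtain ⟨i, -, rfl⟩ := Finset.mem_image.1 hf; exact i.1.2)
      (1 / (((v.sup fun i => i.2 : ℕ) : ℝ) + 1)) (by positivity)
    refine ⟨toWeakSpace 𝕜 E y, ⟨⟨y, hyK, rfl⟩, subset_closure ⟨y, subset_closure hyS, rfl⟩⟩, ?_⟩
    simp only [Set.mem_iInter]
    intro i hi
    have h₁ := hy i.1.1 (Finset.mem_image_of_mem _ hi)
    have h₂ : (i.2 : ℝ) ≤ ((v.sup fun i => i.2 : ℕ) : ℝ) :=
      Nat.cast_le.2 (Finset.le_sup (f := fun i : D × ℕ => i.2) hi)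
    simp only [t, Set.mem_ofPred_eq, LinearEquiv.symm_apply_apply]
    exact h₁.le.trans (by gcongr))
  -- Mazur: a convex set has the same weak and norm closure.
  rw [← hconv.toWeakSpace_closure 𝕜, closure_closure] at hz
  obtain ⟨y, hy, rfl⟩ := hz
  refine ⟨y, hy, x - y, fun f hf => ?_, by simp⟩
  have hle (n : ℕ) : ‖f y - f x‖ ≤ 1 / ((n : ℝ) + 1) := by
    simpa [t] using Set.mem_iInter.1 hzt (⟨f, hf⟩, n)
  have h0 : ‖f y - f x‖ ≤ 0 :=
    ge_of_tendsto' tendsto_one_div_add_atTop_nhds_zero_nat hle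
  rw [map_sub, ← neg_sub, norm_le_zero_iff.1 h0, neg_zero]

namespace ElementaryModel

/-! ### Codes of numbers -/

theorem natSet_mem_natSet {m n : ℕ} (h : m < n) : natSet.{u} m ∈ natSet.{u} n := by
  induction n, h using Nat.le_induction with
  | base => exact ZFSet.mem_insert _ _
  | succ n _ ih => exact ZFSet.mem_insert_of_mem _ ih

theorem natSet_injective : Function.Injective natSet.{u} := by
  intro m n h
  by_contra hne
  rcases lt_or_gt_of_ne hne with hlt | hlt
  · exact ZFSet.mem_irrefl _ (h ▸ natSet_mem_natSet hlt)
  · exact ZFSet.mem_irrefl _ (h ▸ natSet_mem_natSet hlt)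

theorem ratSet_injective : Function.Injective ratSet.{u} := by
  intro p q h
  obtain ⟨hnum, hden⟩ := ZFSet.pair_inj.1 h
  obtain ⟨h₁, h₂⟩ := ZFSet.pair_inj.1 hnum
  have h₁ := natSet_injective h₁
  have h₂ := natSet_injective h₂
  exact Rat.ext (by omega) (natSet_injective hden)

/-- Turns comparison with a rational into membership, so that slices become definable. -/
theorem ratSet_mem_cutSet {q : ℚ} {r : ℝ} : ratSet.{u} q ∈ cutSet.{u} r ↔ (q : ℝ) < r := by
  rw [cutSet, ZFSet.mem_range]
  constructor
  · rintro ⟨p, hp⟩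
    rw [← ratSet_injective hp]
    exact p.2
  · exact fun h => ⟨⟨q, h⟩, rfl⟩

/-! ### Codes of subsets, functionals and the addition -/

section BanachSpace

variable {𝕜 : Type} [RCLike 𝕜] {X : ZFSet.{u}}

theorem mem_subsetSet {K : Set X} {p : ZFSet.{u}} :
    p ∈ subsetSet K ↔ ∃ x : X, x ∈ K ∧ (x : ZFSet.{u}) = p := by
  simp only [subsetSet, ZFSet.mem_range, Subtype.exists, exists_prop]

theorem sep_subsetSet {K : Set X} {R : ZFSet.{u} → Prop} :
    ZFSet.sep R (subsetSet K) = subsetSet {x ∈ K | R x} := by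
  ext p
  simp only [ZFSet.mem_sep, mem_subsetSet]
  constructor
  · rintro ⟨⟨x, hx, rfl⟩, h⟩
    exact ⟨x, ⟨hx, h⟩, rfl⟩
  · rintro ⟨x, ⟨hx, h⟩, rfl⟩
    exact ⟨⟨x, hx, rfl⟩, h⟩

variable [NormedAddCommGroup X]

theorem pair_mem_functionalSet [NormedSpace 𝕜 X] {f : StrongDual 𝕜 X} {x : X} {r i : ZFSet.{u}} :
    ZFSet.pair x (ZFSet.pair r i) ∈ functionalSet f ↔
      r = cutSet (RCLike.re (f x)) ∧ i = cutSet (RCLike.im (f x)) := by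
  simp only [functionalSet, scalarSet, ZFSet.mem_range, ZFSet.pair_inj]
  constructor
  · rintro ⟨y, hy, h₁, h₂⟩
    obtain rfl := Subtype.ext hy
    exact ⟨h₁.symm, h₂.symm⟩
  · rintro ⟨rfl, rfl⟩
    exact ⟨x, rfl, rfl, rfl⟩

theorem pair_mem_additionSet {x y : X} {s : ZFSet.{u}} :
    ZFSet.pair (ZFSet.pair x y) s ∈ additionSet X ↔ s = (x + y : X) := by
  simp only [additionSet, ZFSet.mem_range, ZFSet.pair_inj]
  constructor
  · rintro ⟨⟨x', y'⟩, ⟨hx, hy⟩, h⟩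
    obtain rfl := Subtype.ext hx
    obtain rfl := Subtype.ext hy
    exact h.symm
  · rintro rfl
    exact ⟨(x, y), ⟨rfl, rfl⟩, rfl⟩

end BanachSpace

/-! ### Closure properties of suitable models -/

/-- The model `M` is closed under cutting coded subsets of Banach spaces by the half-spaces given
by functionals in `M` and rational bounds on their real or imaginary parts. -/
def ClosedUnderSlices (M : ZFSet.{u}) : Prop :=
  ∀ (𝕜 : Type) [RCLike 𝕜] (X : ZFSet.{u}) [NormedAddCommGroup X] [NormedSpace 𝕜 X]
    (L : Set X) (f : StrongDual 𝕜 X) (q : ℚ), subsetSet L ∈ M → functionalSet f ∈ M →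
    subsetSet {x ∈ L | (q : ℝ) < RCLike.re (f x)} ∈ M ∧
    subsetSet {x ∈ L | RCLike.re (f x) ≤ q} ∈ M ∧
    subsetSet {x ∈ L | (q : ℝ) < RCLike.im (f x)} ∈ M ∧
    subsetSet {x ∈ L | RCLike.im (f x) ≤ q} ∈ M

theorem forSuitableModels_closedUnderSlices : ForSuitableModels.{u} ClosedUnderSlices := by
  -- Parameters `a 0`, `a 1`, `a 2` code the set, the functional and the rational; `r` and `i` are
  -- the cuts of the real and imaginary parts.
  have h₁ := ForSuitableModels.sep_mem.{u}
    (R := fun p a => ∃ r i, ZFSet.pair p (ZFSet.pair r i) ∈ a 1 ∧ a 2 ∈ r)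
    (.ex (.ex (.and (.pair_pair_mem_right 2 1 0 4) (.mem 5 1))))
  have h₂ := ForSuitableModels.sep_mem.{u}
    (R := fun p a => ∃ r i, ZFSet.pair p (ZFSet.pair r i) ∈ a 1 ∧ ¬ a 2 ∈ r)
    (.ex (.ex (.and (.pair_pair_mem_right 2 1 0 4) (.not (.mem 5 1)))))
  have h₃ := ForSuitableModels.sep_mem.{u}
    (R := fun p a => ∃ r i, ZFSet.pair p (ZFSet.pair r i) ∈ a 1 ∧ a 2 ∈ i)
    (.ex (.ex (.and (.pair_pair_mem_right 2 1 0 4) (.mem 5 0))))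
  have h₄ := ForSuitableModels.sep_mem.{u}
    (R := fun p a => ∃ r i, ZFSet.pair p (ZFSet.pair r i) ∈ a 1 ∧ ¬ a 2 ∈ i)
    (.ex (.ex (.and (.pair_pair_mem_right 2 1 0 4) (.not (.mem 5 0)))))
  refine ((ForSuitableModels.range_mem ratSet.{u}).and (h₁.and (h₂.and (h₃.and h₄)))).mono ?_
  rintro M ⟨hq, h₁, h₂, h₃, h₄⟩ 𝕜 _ X _ _ L f q hL hf
  let a : ℕ → ZFSet.{u} := consSeq (subsetSet L) (consSeq (functionalSet f) fun _ => ratSet q)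
  have ha : ∀ i, a i ∈ M
    | 0 => hL
    | 1 => hf
    | _ + 2 => hq q
  refine ⟨?_, ?_, ?_, ?_⟩
  · simpa [a, consSeq, sep_subsetSet, pair_mem_functionalSet, ratSet_mem_cutSet] using h₁ a ha
  · simpa [a, consSeq, sep_subsetSet, pair_mem_functionalSet, ratSet_mem_cutSet] using h₂ a ha
  · simpa [a, consSeq, sep_subsetSet, pair_mem_functionalSet, ratSet_mem_cutSet] using h₃ a ha
  · simpa [a, consSeq, sep_subsetSet, pair_mem_functionalSet, ratSet_mem_cutSet] using h₄ a ha

theorem forSuitableModels_exists_midpoint :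
    ForSuitableModels.{u} fun M => ∀ (𝕜 : Type) [RCLike 𝕜] (X : ZFSet.{u})
      [NormedAddCommGroup X] [NormedSpace 𝕜 X], banachSpaceSet 𝕜 X ∈ M →
      ∀ x ∈ pointsIn X M, ∀ y ∈ pointsIn X M, ∃ m ∈ pointsIn X M, m + m = x + y := by
  -- Stating the midpoint as `m + m = x + y` needs only the graph of addition, with `s` the common
  -- sum.
  have h := ForSuitableModels.exists_mem.{u}
    (R := fun m a => m ∈ a 3 ∧ ∃ s, ZFSet.pair (ZFSet.pair m m) s ∈ a 0 ∧
      ZFSet.pair (ZFSet.pair (a 1) (a 2)) s ∈ a 0)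
    (.and (.mem 0 4) (.ex (.and (.pair_pair_mem_left 1 1 0 2) (.pair_pair_mem_left 3 4 0 2))))
  refine (ForSuitableModels.pair_components_mem.and h).mono ?_
  rintro M ⟨hpair, h⟩ 𝕜 _ X _ _ hX x hx y hy
  obtain ⟨hXM, hrest⟩ := hpair _ _ hX
  obtain ⟨hadd, -⟩ := hpair _ _ hrest
  let a : ℕ → ZFSet.{u} := consSeq (additionSet X) (consSeq x (consSeq y fun _ => X))
  have ha : ∀ i, a i ∈ M
    | 0 => hadd
    | 1 => hx
    | 2 => hy
    | _ + 3 => hXM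
  have hm : (2⁻¹ : 𝕜) • (x + y) + (2⁻¹ : 𝕜) • (x + y) = x + y := by
    rw [← add_smul, ← two_mul, mul_inv_cancel₀ two_ne_zero, one_smul]
  obtain ⟨m, hmM, hmX, s, h₁, h₂⟩ := h a ha ⟨((2⁻¹ : 𝕜) • (x + y) : X), Subtype.prop _,
    (x + y : X), pair_mem_additionSet.2 (by rw [hm]), pair_mem_additionSet.2 rfl⟩
  lift m to X using hmX
  exact ⟨m, hmM, Subtype.ext
    ((pair_mem_additionSet.1 h₁).symm.trans (pair_mem_additionSet.1 h₂))⟩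

theorem exists_rat_abs_sub_lt {ε : ℝ} (hε : 0 < ε) (r : ℝ) :
    ∃ p q : ℚ, (p : ℝ) < r ∧ r ≤ q ∧ ∀ s : ℝ, (p : ℝ) < s → s ≤ q → |s - r| < ε := by
  obtain ⟨p, hp, hpr⟩ := exists_rat_btwn (sub_lt_self r hε)
  obtain ⟨q, hrq, hq⟩ := exists_rat_btwn (lt_add_of_pos_right r hε)
  exact ⟨p, q, hpr, hrq.le, fun s h₁ h₂ => abs_lt.2 ⟨by linarith, by linarith⟩⟩

theorem ClosedUnderSlices.exists_subset {M : ZFSet.{u}} (hM : ClosedUnderSlices M)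
    {𝕜 : Type} [RCLike 𝕜] {X : ZFSet.{u}} [NormedAddCommGroup X] [NormedSpace 𝕜 X]
    {K : Set X} (hK : subsetSet K ∈ M) {x : X} (hx : x ∈ K) {ε : ℝ} (hε : 0 < ε)
    (F : Finset (StrongDual 𝕜 X)) (hF : ↑F ⊆ functionalsIn 𝕜 X M) :
    ∃ L ⊆ K, subsetSet L ∈ M ∧ x ∈ L ∧ ∀ f ∈ F, ∀ y ∈ L, ‖f y - f x‖ < ε := by
  classical
  induction F using Finset.induction_on with
  | empty => exact ⟨K, subset_rfl, hK, hx, by simp⟩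
  | insert f F _ ih =>
    rw [Finset.coe_insert, Set.insert_subset_iff] at hF
    obtain ⟨L, hLK, hLM, hxL, hL⟩ := ih hF.2
    -- Half of `ε` for each of the real and imaginary parts, since the norm is at most the sum of
    -- their absolute values.
    obtain ⟨p, q, hp, hq, hpq⟩ := exists_rat_abs_sub_lt (half_pos hε) (RCLike.re (f x))
    obtain ⟨p', q', hp', hq', hpq'⟩ := exists_rat_abs_sub_lt (half_pos hε) (RCLike.im (f x))
    have h₁ := (hM 𝕜 X _ f p hLM hF.1).1
    have h₂ := (hM 𝕜 X _ f q h₁ hF.1).2.1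
    have h₃ := (hM 𝕜 X _ f p' h₂ hF.1).2.2.1
    have h₄ := (hM 𝕜 X _ f q' h₃ hF.1).2.2.2
    refine ⟨_, ?_, h₄, ⟨⟨⟨⟨hxL, hp⟩, hq⟩, hp'⟩, hq'⟩, ?_⟩
    · rintro y ⟨⟨⟨⟨hyL, -⟩, -⟩, -⟩, -⟩
      exact hLK hyL
    · rintro g hg y ⟨⟨⟨⟨hyL, hyp⟩, hyq⟩, hyp'⟩, hyq'⟩
      obtain rfl | hg := Finset.mem_insert.1 hg
      · have hre := hpq _ hyp hyq
        have him := hpq' _ hyp' hyq'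
        rw [← map_sub] at hre him
        calc ‖g y - g x‖
            = ‖(RCLike.re (g y - g x) : 𝕜) + RCLike.im (g y - g x) * RCLike.I‖ := by
              rw [RCLike.re_add_im]
          _ ≤ |RCLike.re (g y - g x)| + |RCLike.im (g y - g x)| := by
              refine (norm_add_le _ _).trans (add_le_add (RCLike.norm_ofReal _).le ?_)
              rw [norm_mul, RCLike.norm_ofReal]
              exact mul_le_of_le_one_right (abs_nonneg _) (by rw [RCLike.norm_I]; split_ifs <;> norm_num)
          _ < ε := by linarith
      · exact hL g hg y hyL

end ElementaryModel

open ElementaryModel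

theorem propositionP :
    ElementaryModel.ForSuitableModels.{u} fun M : ZFSet.{u} =>
      ∀ (𝕜 : Type) [RCLike 𝕜] (X : ZFSet.{u})
        [NormedAddCommGroup X] [NormedSpace 𝕜 X] [CompleteSpace X]
        (K : Set X), IsCompact (toWeakSpace 𝕜 X '' K) →
        ElementaryModel.banachSpaceSet 𝕜 X ∈ M →
        ElementaryModel.subsetSet K ∈ M →
        K ⊆ closure (ElementaryModel.pointsIn X M) +
          ElementaryModel.preAnnihilator (ElementaryModel.functionalsIn 𝕜 X M) := by
  refine (ForSuitableModels.exists_mem_of_nonempty.and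
    (forSuitableModels_closedUnderSlices.and forSuitableModels_exists_midpoint)).mono ?_
  rintro M ⟨hne, hslices, hmid⟩ 𝕜 _ X _ _ _ K hKc hX hK
  refine subset_closure_add_of_isCompact_toWeakSpace hKc (hmid 𝕜 X hX) fun x hx F hF ε hε => ?_
  obtain ⟨L, hLK, hLM, hxL, hL⟩ := hslices.exists_subset hK hx hε F hF
  obtain ⟨y, hyM, hy⟩ := hne _ hLM x (mem_subsetSet.2 ⟨x, hxL, rfl⟩)
  obtain ⟨y, hyL, rfl⟩ := mem_subsetSet.1 hy
  exact ⟨y, hLK hyL, hyM, fun f hf => hL f hf y hyL⟩
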